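/- Let $R$ be a noetherian local ring that is formally integral, i.e. whose formal completion $\hat R=\varprojlim_n R/\mathfrak m_R^n$ is an integral domain. Let $p\ge 1$ be the characteristic exponent of $\operatorname{Frac}(R)$, and let $$R^{\mathrm{prc}}=\{b\in\hat R \mid b^{p^\nu}\in R \text{ for some } \nu\ge 0\}$$ be the $p$-radical closure of $R$, a subring of $\hat R$ containing $R$. Let $R\subset B\subset R^{\mathrm{prc}}$ be an intermediate ring; it is a local ring, and the inclusion $R\subset B$ is a local homomorphism. Suppose that $B$ is noetherian and that its generic formal fiber is reduced, i.e. $\hat B\otimes_B\kappa(\mathfrak p)$ is reduced for every minimal prime ideal $\mathfrak p$ of $B$, where $\hat B=\varprojlim_n B/\mathfrak m_B^n$. Then: 1. the ramification index $e=\operatorname{length}_B(B/\mathfrak m_RB)$ and the residual degree $f=[\kappa(B):\kappa(R)]$ both equal $1$; 2. $B$ is faithfully flat over $R$; 3. the induced map $\hat R\to\hat B$ is bijective; 4. if $B\ne R$, then $B$ is not a finite $R$-algebra. -/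

import Mathlib

open IsLocalRing
open scoped TensorProduct

noncomputable section

universe u v

/-- The formal completion of a local ring: the inverse limit of the rings `R ⧸ 𝔪 ^ n`. -/
abbrev FormalCompletion (R : Type u) [CommRing R] [IsLocalRing R] : Type u :=
  AdicCompletion (maximalIdeal R) R

section LocalExtension

variable (R : Type u) (A : Type v) [CommRing R] [IsLocalRing R] [CommRing A] [IsLocalRing A]
  [Algebra R A] [IsLocalHom (algebraMap R A)]

theorem maximalIdeal_pow_le_comap (n : ℕ) :
    maximalIdeal R ^ n ≤ (maximalIdeal A ^ n).comap (algebraMap R A) := by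
  have h : (maximalIdeal R).map (algebraMap R A) ≤ maximalIdeal A :=
    Ideal.map_le_iff_le_comap.mpr (maximalIdeal_comap (algebraMap R A)).ge
  rw [← Ideal.map_le_iff_le_comap, Ideal.map_pow]
  exact Ideal.pow_right_mono h n

theorem formalCompletionMap_compatible {m n : ℕ} (hle : m ≤ n) :
    (Ideal.Quotient.factorPow (maximalIdeal A) hle).comp
      ((Ideal.quotientMap (maximalIdeal A ^ n) (algebraMap R A)
        (maximalIdeal_pow_le_comap R A n)).comp
          (AdicCompletion.evalₐ (maximalIdeal R) n : FormalCompletion R →+* _)) =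
      (Ideal.quotientMap (maximalIdeal A ^ m) (algebraMap R A)
        (maximalIdeal_pow_le_comap R A m)).comp
          (AdicCompletion.evalₐ (maximalIdeal R) m : FormalCompletion R →+* _) := by
  ext x
  obtain ⟨x, rfl⟩ := AdicCompletion.mk_surjective _ _ x
  simp only [RingHom.coe_comp, RingHom.coe_coe, Function.comp_apply, AdicCompletion.evalₐ_mk,
    Ideal.quotientMap_mk]
  have h : Ideal.Quotient.mk (maximalIdeal R ^ m) (x.val m)
      = Ideal.Quotient.mk (maximalIdeal R ^ m) (x.val n) := by
    rw [Ideal.Quotient.mk_eq_mk_iff_sub_mem]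
    have := x.property hle
    rw [SModEq.sub_mem] at this
    simpa using this
  have h2 := congrArg (Ideal.quotientMap (maximalIdeal A ^ m) (algebraMap R A)
    (maximalIdeal_pow_le_comap R A m)) h
  simp only [Ideal.quotientMap_mk] at h2
  rw [h2]
  rfl

/-- The map on formal completions induced by a local homomorphism `R → A`: on the `n`-th level
it is the composite of the projection to `R ⧸ 𝔪_R ^ n` and the map
`R ⧸ 𝔪_R ^ n → A ⧸ 𝔪_A ^ n` induced by `R → A`. -/
def formalCompletionMap : FormalCompletion R →+* FormalCompletion A :=
  AdicCompletion.liftRingHom (maximalIdeal A)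
    (fun n => (Ideal.quotientMap (maximalIdeal A ^ n) (algebraMap R A)
      (maximalIdeal_pow_le_comap R A n)).comp
        (AdicCompletion.evalₐ (maximalIdeal R) n : FormalCompletion R →+* _))
    (formalCompletionMap_compatible R A)

/-- The ramification index `e = length_A (A ⧸ 𝔪_R A)`, an element of `ℕ∞`. -/
def ramificationIndex : ℕ∞ :=
  Module.length A (A ⧸ (maximalIdeal R).map (algebraMap R A))

/-- The residual degree `f = [κ(A) : κ(R)]`, an element of `ℕ∞`. -/
def residualDegree : ℕ∞ :=
  Cardinal.toENat (Module.rank (ResidueField R) (ResidueField A))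

end LocalExtension

/-- The generic formal fibers of a local ring `A`, that is, the rings `Â ⊗ κ(𝔭)` for the minimal
prime ideals `𝔭` of `A`, are reduced. -/
def HasReducedGenericFormalFiber (A : Type u) [CommRing A] [IsLocalRing A] : Prop :=
  ∀ (𝔭 : Ideal A) [𝔭.IsPrime], 𝔭 ∈ minimalPrimes A →
    IsReduced (FormalCompletion A ⊗[A] 𝔭.ResidueField)

section PRadicalClosure

variable (R : Type u) [CommRing R] [IsLocalRing R] [IsNoetherianRing R]

theorem algebraMap_formalCompletion_injective :
    Function.Injective (algebraMap R (FormalCompletion R)) := by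
  have : IsHausdorff (maximalIdeal R) R := inferInstance
  exact AdicCompletion.of_injective (maximalIdeal R) R

/-- The characteristic exponent of the field of fractions of `R`. -/
def fracExpChar : ℕ := ringExpChar (FractionRing R)

theorem expChar_formalCompletion [IsDomain (FormalCompletion R)] :
    ExpChar (FormalCompletion R) (fracExpChar R) := by
  have : IsDomain R := (algebraMap_formalCompletion_injective R).isDomain _
  have : ExpChar (FractionRing R) (fracExpChar R) := ringExpChar.expChar (FractionRing R)
  have : ExpChar R (fracExpChar R) :=
    (algebraMap R (FractionRing R)).expChar (IsFractionRing.injective R (FractionRing R)) _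
  exact expChar_of_injective_algebraMap (algebraMap_formalCompletion_injective R) _

/-- The `p`-radical closure of a formally integral local noetherian ring `R`: the subring of all
`b` in the formal completion with `b ^ (p ^ ν)` in `R` for some `ν ≥ 0`, where `p` is the
characteristic exponent of the field of fractions of `R`. -/
def pRadicalClosure [IsDomain (FormalCompletion R)] : Subalgebra R (FormalCompletion R) where
  carrier := {b | ∃ ν : ℕ, ∃ a : R, b ^ (fracExpChar R ^ ν) = algebraMap R (FormalCompletion R) a}
  algebraMap_mem' r := ⟨0, r, by simp⟩
  mul_mem' := by
    rintro x y ⟨m, a, ha⟩ ⟨n, b, hb⟩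
    refine ⟨m + n, a ^ (fracExpChar R ^ n) * b ^ (fracExpChar R ^ m), ?_⟩
    rw [mul_pow, map_mul, map_pow, map_pow, ← ha, ← hb, ← pow_mul, ← pow_mul, ← pow_add,
      ← pow_add, add_comm n m]
  add_mem' := by
    rintro x y ⟨m, a, ha⟩ ⟨n, b, hb⟩
    have := expChar_formalCompletion R
    refine ⟨m + n, a ^ (fracExpChar R ^ n) + b ^ (fracExpChar R ^ m), ?_⟩
    rw [add_pow_expChar_pow, map_add, map_pow, map_pow, ← ha, ← hb, ← pow_mul, ← pow_mul,
      ← pow_add, ← pow_add, add_comm n m]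

variable {R} [IsDomain (FormalCompletion R)]

theorem isLocalHom_intermediate_val (B : Subalgebra R (pRadicalClosure R)) :
    IsLocalHom ((pRadicalClosure R).val.comp B.val : B →+* FormalCompletion R) := by
  refine ⟨fun b hb => ?_⟩
  obtain ⟨ν, a, ha⟩ := b.1.2
  have hp : fracExpChar R ^ ν ≠ 0 := by
    have := expChar_formalCompletion R
    exact pow_ne_zero _ (expChar_ne_zero (FormalCompletion R) (fracExpChar R))
  have hba : b ^ (fracExpChar R ^ ν) = algebraMap R B a := Subtype.ext (Subtype.ext ha)
  have hu : IsUnit (algebraMap R (FormalCompletion R) a) := ha ▸ hb.pow _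
  have hu' : IsUnit a := isUnit_of_map_unit (algebraMap R (FormalCompletion R)) a hu
  exact (isUnit_pow_iff hp).mp (hba ▸ hu'.map (algebraMap R B))

/-- Every intermediate ring `R ⊆ B ⊆ R^prc` is local. -/
instance isLocalRing_intermediate (B : Subalgebra R (pRadicalClosure R)) : IsLocalRing B :=
  have := isLocalHom_intermediate_val B
  RingHom.domain_isLocalRing ((pRadicalClosure R).val.comp B.val : B →+* FormalCompletion R)

/-- For every intermediate ring `R ⊆ B ⊆ R^prc` the inclusion `R → B` is local. -/
instance isLocalHom_intermediate (B : Subalgebra R (pRadicalClosure R)) :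
    IsLocalHom (algebraMap R B) := by
  refine ⟨fun a ha => ?_⟩
  have h := ha.map ((pRadicalClosure R).val.comp B.val : B →+* FormalCompletion R)
  exact isUnit_of_map_unit (algebraMap R (FormalCompletion R)) a h

end PRadicalClosure

end

/-! All conclusions follow from the bijectivity of `R̂ → B̂`. Injectivity: for `b ∈ 𝔪_B`, some power
of `b` lies in `𝔪_R`, so `𝔪_B ^ n` dies in `R ⧸ 𝔪_R ^ n` (`evalₐ_intermediateVal_eq_zero`), whence
`𝔪_B ^ n ∩ R = 𝔪_R ^ n`. Surjectivity: by the same lemma `B ⊆ R̂` extends to a map `B̂ → R̂`. It is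
a section of `R̂ → B̂` once each `b ∈ B ⊆ R̂` maps to `b` in `B̂`. The two images agree after a
`p`-power Frobenius, hence agree because `B̂` is reduced; only here does the fiber hypothesis enter.
Then `R` is dense in `B`: Nakayama gives `𝔪_R B = 𝔪_B`, the residue fields coincide, and a finite
`B` equals `R`. Flatness of `R → R̂ ≅ B̂` descends along `B → B̂`. -/

/-- Flatness descends from the top of a tower `R → A → C` to `A` when `C` is faithfully flat
over `A`. -/
theorem Module.Flat.of_faithfullyFlat_tower (R A C : Type*) [CommRing R] [CommRing A] [CommRing C]
    [Algebra R A] [Algebra A C] [Algebra R C] [IsScalarTower R A C]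
    [Module.FaithfullyFlat A C] [Module.Flat R C] : Module.Flat R A := by
  rw [Module.Flat.iff_lTensor_preserves_injective_linearMap]
  intro N P _ _ _ _ f hf
  -- Base change in stages: `C ⊗[A] (A ⊗[R] N) ≅ C ⊗[R] N`, naturally in `N`.
  have h : Function.Injective (LinearMap.lTensor C
      (TensorProduct.AlgebraTensorModule.lTensor A A f)) := by
    have hC := Module.Flat.lTensor_preserves_injective_linearMap (M := C) f hf
    have key := TensorProduct.AlgebraTensorModule.lTensor_comp_cancelBaseChange R A A (M := C) f
    have key' : ∀ x, TensorProduct.AlgebraTensorModule.cancelBaseChange R A A C P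
        (LinearMap.lTensor C (TensorProduct.AlgebraTensorModule.lTensor A A f) x) =
        LinearMap.lTensor C f (TensorProduct.AlgebraTensorModule.cancelBaseChange R A A C N x) :=
      fun x => (LinearMap.congr_fun key x).symm
    intro x y hxy
    apply (TensorProduct.AlgebraTensorModule.cancelBaseChange R A A C N).injective
    apply hC
    rw [← key', ← key', hxy]
  exact (Module.FaithfullyFlat.lTensor_injective_iff_injective A C _).mp h

/-! ### Completions of noetherian local rings. -/

section AdicCompletion

theorem evalₐ_eq_factorPow {A : Type*} [CommRing A] {I : Ideal A} {m n : ℕ} (h : m ≤ n)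
    (x : AdicCompletion I A) :
    AdicCompletion.evalₐ I m x =
      Ideal.Quotient.factorPow I h (AdicCompletion.evalₐ I n x) := by
  obtain ⟨c, rfl⟩ := AdicCompletion.mk_surjective _ _ x
  rw [AdicCompletion.evalₐ_mk, AdicCompletion.evalₐ_mk]
  exact (AdicCompletion.Ideal.mk_eq_mk I h c).symm

variable (A : Type u) [CommRing A] [IsLocalRing A] [IsNoetherianRing A]

/-- A noetherian local ring has faithfully flat formal completion. -/
instance faithfullyFlat_formalCompletion : Module.FaithfullyFlat A (FormalCompletion A) := by
  refine ⟨fun m hm h => ?_⟩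
  rw [Ideal.smul_top_eq_map, Submodule.restrictScalars_eq_top_iff, eq_maximalIdeal hm,
    Ideal.eq_top_iff_one] at h
  have hle : (maximalIdeal A).map (algebraMap A (FormalCompletion A)) ≤
      RingHom.ker (AdicCompletion.evalₐ (maximalIdeal A) 1) := by
    rw [Ideal.map_le_iff_le_comap]
    intro a ha
    rw [Ideal.mem_comap, RingHom.mem_ker, AlgHom.commutes]
    exact Ideal.Quotient.eq_zero_iff_mem.mpr (by simpa using ha)
  have h1 := hle h
  rw [RingHom.mem_ker, map_one] at h1
  have : (1 : A) ∈ maximalIdeal A ^ 1 := Ideal.Quotient.eq_zero_iff_mem.mp (by simpa using h1)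
  rw [pow_one] at this
  exact (Ideal.ne_top_iff_one _).mp (maximalIdeal.isMaximal A).ne_top this

/-- If the generic formal fibers of a noetherian local domain are reduced, so is its formal
completion. -/
theorem HasReducedGenericFormalFiber.isReduced [IsDomain A]
    (h : HasReducedGenericFormalFiber A) : IsReduced (FormalCompletion A) := by
  have := h ⊥ (by rw [IsDomain.minimalPrimes_eq_singleton_bot]; rfl)
  -- By flatness, `A → Frac A` stays injective after tensoring with the completion.
  exact isReduced_of_injective
    (Algebra.TensorProduct.includeLeft : FormalCompletion A →ₐ[A]
      FormalCompletion A ⊗[A] (⊥ : Ideal A).ResidueField)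
    (Algebra.TensorProduct.includeLeft_injective
      (IsFractionRing.injective A (⊥ : Ideal A).ResidueField))

end AdicCompletion

/-! ### Consequences of surjectivity or bijectivity on completions. -/

section LocalExtension

variable {R : Type u} {A : Type v} [CommRing R] [IsLocalRing R] [CommRing A] [IsLocalRing A]
  [Algebra R A] [IsLocalHom (algebraMap R A)]

theorem evalₐ_formalCompletionMap (n : ℕ) (x : FormalCompletion R) :
    AdicCompletion.evalₐ (maximalIdeal A) n (formalCompletionMap R A x) =
      Ideal.quotientMap (maximalIdeal A ^ n) (algebraMap R A) (maximalIdeal_pow_le_comap R A n)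
        (AdicCompletion.evalₐ (maximalIdeal R) n x) :=
  AdicCompletion.evalₐ_liftRingHom _ _ _ _ _

theorem formalCompletionMap_algebraMap (r : R) :
    formalCompletionMap R A (algebraMap R (FormalCompletion R) r) =
      algebraMap A (FormalCompletion A) (algebraMap R A r) := by
  refine AdicCompletion.ext_evalₐ fun n => ?_
  rw [evalₐ_formalCompletionMap, AlgHom.commutes, AlgHom.commutes]
  exact Ideal.quotientMap_mk

/-- If the map on formal completions is surjective, `R` surjects onto every `A ⧸ 𝔪_A ^ n`. -/
theorem exists_sub_mem_of_formalCompletionMap_surjective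
    (h : Function.Surjective (formalCompletionMap R A)) (n : ℕ) (a : A) :
    ∃ r : R, a - algebraMap R A r ∈ maximalIdeal A ^ n := by
  obtain ⟨x, hx⟩ := h (algebraMap A _ a)
  obtain ⟨r, hr⟩ := Ideal.Quotient.mk_surjective (AdicCompletion.evalₐ (maximalIdeal R) n x)
  refine ⟨r, ?_⟩
  rw [← Ideal.Quotient.mk_eq_mk_iff_sub_mem]
  have := evalₐ_formalCompletionMap (A := A) n x
  rw [hx, ← hr, AlgHom.commutes, Ideal.quotientMap_mk] at this
  exact this

/-- Approximating modulo `𝔪_A ^ 2` gives `𝔪_A ⊆ 𝔪_R A + 𝔪_A ^ 2`, and Nakayama applies. -/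
theorem map_maximalIdeal_of_formalCompletionMap_surjective [IsNoetherianRing A]
    (h : Function.Surjective (formalCompletionMap R A)) :
    (maximalIdeal R).map (algebraMap R A) = maximalIdeal A := by
  refine le_antisymm (Ideal.map_le_iff_le_comap.mpr (maximalIdeal_comap (algebraMap R A)).ge) ?_
  refine Submodule.le_of_le_smul_of_le_jacobson_bot (I := maximalIdeal A)
    (IsNoetherian.noetherian _) (maximalIdeal_le_jacobson _) fun a ha => ?_
  obtain ⟨r, hr⟩ := exists_sub_mem_of_formalCompletionMap_surjective h 2 a
  rw [← sub_add_cancel a (algebraMap R A r), add_comm]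
  refine Submodule.add_mem_sup (Ideal.mem_map_of_mem _ ?_) (by rwa [smul_eq_mul, ← sq])
  rw [← maximalIdeal_comap (algebraMap R A), Ideal.mem_comap, ← sub_sub_cancel a (algebraMap R A r)]
  exact sub_mem ha (Ideal.pow_le_self two_ne_zero hr)

theorem ramificationIndex_eq_one [IsNoetherianRing A]
    (h : Function.Surjective (formalCompletionMap R A)) : ramificationIndex R A = 1 := by
  rw [ramificationIndex, map_maximalIdeal_of_formalCompletionMap_surjective h,
    Module.length_eq_one_iff, isSimpleModule_iff_isCoatom]
  exact Ideal.isMaximal_def.mp (maximalIdeal.isMaximal A)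

theorem residualDegree_eq_one
    (h : Function.Surjective (formalCompletionMap R A)) : residualDegree R A = 1 := by
  have hs : Function.Surjective (algebraMap (ResidueField R) (ResidueField A)) := by
    intro y
    obtain ⟨a, rfl⟩ := residue_surjective y
    obtain ⟨r, hr⟩ := exists_sub_mem_of_formalCompletionMap_surjective h 1 a
    refine ⟨residue R r, ?_⟩
    have h0 := (residue_eq_zero_iff _).mpr (pow_one (maximalIdeal A) ▸ hr)
    rw [map_sub, sub_eq_zero] at h0
    exact h0.symm
  have e : ResidueField R ≃ₗ[ResidueField R] ResidueField A :=
    LinearEquiv.ofBijective (Algebra.linearMap _ _) ⟨(algebraMap (ResidueField R) (ResidueField A)).injective, hs⟩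
  have hr := e.lift_rank_eq
  rw [Module.rank_self, Cardinal.lift_one, eq_comm, Cardinal.lift_eq_one] at hr
  rw [residualDegree, hr, map_one]

theorem faithfullyFlat_of_formalCompletionMap_bijective [IsNoetherianRing R] [IsNoetherianRing A]
    (h : Function.Bijective (formalCompletionMap R A)) : Module.FaithfullyFlat R A := by
  let f : FormalCompletion R →ₗ[R] FormalCompletion A :=
    { (formalCompletionMap R A).toAddMonoidHom with
      map_smul' := fun r x => by
        have := (formalCompletionMap R A).map_mul (algebraMap R _ r) x
        rw [formalCompletionMap_algebraMap] at this
        rw [Algebra.smul_def, RingHom.id_apply, ← algebraMap_smul A r, Algebra.smul_def]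
        exact this }
  have : Module.Flat R (FormalCompletion A) :=
    Module.Flat.of_linearEquiv (LinearEquiv.ofBijective f h).symm
  have : Module.Flat R A := Module.Flat.of_faithfullyFlat_tower R A (FormalCompletion A)
  exact Module.FaithfullyFlat.of_flat_of_isLocalHom

/-- A finite local extension whose map on formal completions is surjective is surjective. -/
theorem algebraMap_surjective_of_finite [IsNoetherianRing R] [Module.Finite R A]
    (h : Function.Surjective (formalCompletionMap R A)) :
    Function.Surjective (algebraMap R A) := by
  have : IsNoetherianRing A := IsNoetherianRing.of_finite R A
  have hm := map_maximalIdeal_of_formalCompletionMap_surjective h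
  -- Nakayama over `R`: `A = R + 𝔪_A = R + 𝔪_R A`.
  have htop : (⊤ : Submodule R A) ≤ LinearMap.range (Algebra.linearMap R A) := by
    refine Submodule.le_of_le_smul_of_le_jacobson_bot (I := maximalIdeal R)
      Module.Finite.fg_top (maximalIdeal_le_jacobson _) fun a _ => ?_
    obtain ⟨r, hr⟩ := exists_sub_mem_of_formalCompletionMap_surjective h 1 a
    rw [← sub_add_cancel a (algebraMap R A r), add_comm]
    refine Submodule.add_mem_sup ⟨r, rfl⟩ ?_
    rw [Ideal.smul_top_eq_map, hm]
    exact pow_one (maximalIdeal A) ▸ hr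
  intro a
  exact htop (Submodule.mem_top (x := a))

end LocalExtension

/-! ### Bijectivity of `R̂ → B̂` for intermediate rings. -/

section PRadicalClosure

variable {R : Type u} [CommRing R] [IsLocalRing R] [IsNoetherianRing R]
  [IsDomain (FormalCompletion R)] (B : Subalgebra R (pRadicalClosure R))

/-- An intermediate ring `R ⊆ B ⊆ R^prc` as a subring of the formal completion of `R`. -/
noncomputable def intermediateVal : B →ₐ[R] FormalCompletion R :=
  (pRadicalClosure R).val.comp B.val

theorem intermediateVal_injective : Function.Injective (intermediateVal B) :=
  Subtype.val_injective.comp Subtype.val_injective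

theorem exists_pow_eq_algebraMap (b : B) :
    ∃ (ν : ℕ) (a : R), b ^ (fracExpChar R ^ ν) = algebraMap R B a := by
  obtain ⟨ν, a, ha⟩ := b.1.2
  exact ⟨ν, a, Subtype.ext (Subtype.ext ha)⟩

variable {B} in
-- If `r ∈ R` approximates `b ∈ 𝔪_B` modulo `𝔪_R ^ n`, then a power of `r` is congruent to an
-- element of `𝔪_R`, so `r ∈ 𝔪_R`. Thus `𝔪_B` lands in `𝔪_R ⧸ 𝔪_R ^ n`, whose `n`-th power is zero.
theorem evalₐ_intermediateVal_eq_zero {n : ℕ} {b : B} (hb : b ∈ maximalIdeal B ^ n) :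
    AdicCompletion.evalₐ (maximalIdeal R) n (intermediateVal B b) = 0 := by
  rcases eq_or_ne n 0 with rfl | hn
  · have : Subsingleton (R ⧸ maximalIdeal R ^ 0) :=
      Ideal.Quotient.subsingleton_iff.mpr (by rw [pow_zero, Ideal.one_eq_top])
    exact Subsingleton.elim _ _
  have hloc : ∀ b ∈ maximalIdeal B, AdicCompletion.evalₐ (maximalIdeal R) n (intermediateVal B b) ∈
      (maximalIdeal R).map (Ideal.Quotient.mk (maximalIdeal R ^ n)) := by
    intro b hb
    obtain ⟨ν, a, ha⟩ := exists_pow_eq_algebraMap B b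
    obtain ⟨r, hr⟩ := Ideal.Quotient.mk_surjective
      (AdicCompletion.evalₐ (maximalIdeal R) n (intermediateVal B b))
    have hp : fracExpChar R ^ ν ≠ 0 := by
      have := expChar_formalCompletion R
      exact pow_ne_zero _ (expChar_ne_zero (FormalCompletion R) (fracExpChar R))
    have ham : a ∈ maximalIdeal R := by
      rw [← maximalIdeal_comap (algebraMap R B), Ideal.mem_comap, ← ha]
      exact Ideal.pow_mem_of_mem _ hb _ (Nat.pos_of_ne_zero hp)
    have h1 : Ideal.Quotient.mk (maximalIdeal R ^ n) (r ^ (fracExpChar R ^ ν)) =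
        Ideal.Quotient.mk (maximalIdeal R ^ n) a := by
      rw [map_pow, hr, ← map_pow, ← map_pow, ha, AlgHom.commutes, AlgHom.commutes]
      rfl
    rw [Ideal.Quotient.mk_eq_mk_iff_sub_mem] at h1
    have h2 : r ^ (fracExpChar R ^ ν) ∈ maximalIdeal R := by
      have := add_mem (Ideal.pow_le_self hn h1) ham
      rwa [sub_add_cancel] at this
    rw [← hr]
    exact Ideal.mem_map_of_mem _ ((maximalIdeal.isMaximal R).isPrime.mem_of_pow_mem _ h2)
  have hle : maximalIdeal B ≤ ((maximalIdeal R).map (Ideal.Quotient.mk (maximalIdeal R ^ n))).comap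
      ((AdicCompletion.evalₐ (maximalIdeal R) n : FormalCompletion R →+* _).comp
        (intermediateVal B : B →+* FormalCompletion R)) := hloc
  have h3 := Ideal.pow_right_mono hle n
  have h4 := Ideal.le_comap_pow _ n (h3 hb)
  rw [Ideal.mem_comap, ← Ideal.map_pow, Ideal.map_quotient_self] at h4
  exact h4

theorem formalCompletionMap_injective_of_intermediate :
    Function.Injective (formalCompletionMap R B) := by
  rw [injective_iff_map_eq_zero]
  intro x hx
  refine AdicCompletion.ext_evalₐ fun n => ?_
  obtain ⟨r, hr⟩ := Ideal.Quotient.mk_surjective (AdicCompletion.evalₐ (maximalIdeal R) n x)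
  have h := evalₐ_formalCompletionMap (A := B) n x
  rw [hx, map_zero, ← hr, Ideal.quotientMap_mk, eq_comm, Ideal.Quotient.eq_zero_iff_mem] at h
  have h0 := evalₐ_intermediateVal_eq_zero h
  rw [AlgHom.commutes, AlgHom.commutes] at h0
  rw [← hr, map_zero]
  exact h0

/-- If the formal completion of `B` is reduced, then every `b ∈ B ⊆ R̂` has the same image in `B̂`
under `R̂ → B̂` and under `B → B̂`, the `q`-th powers of both images being equal
for some power `q` of the characteristic exponent. -/
theorem formalCompletionMap_intermediateVal [IsNoetherianRing B]
    [IsReduced (FormalCompletion B)] (b : B) :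
    formalCompletionMap R B (intermediateVal B b) = algebraMap B (FormalCompletion B) b := by
  obtain ⟨ν, a, ha⟩ := exists_pow_eq_algebraMap B b
  have := expChar_formalCompletion R
  -- Injectivity carries the characteristic exponent to `B̂`, making Frobenius additive there.
  have hB : ExpChar (FormalCompletion B) (fracExpChar R) :=
    expChar_of_injective_ringHom (formalCompletionMap_injective_of_intermediate B) _
  rw [← sub_eq_zero]
  refine eq_zero_of_pow_eq_zero (n := fracExpChar R ^ ν) ?_
  rw [sub_pow_expChar_pow, ← map_pow, ← map_pow, ← map_pow, ha, AlgHom.commutes,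
    formalCompletionMap_algebraMap, sub_self]

theorem formalCompletionMap_surjective_of_intermediate [IsNoetherianRing B]
    [IsReduced (FormalCompletion B)] : Function.Surjective (formalCompletionMap R B) := by
  intro y
  obtain ⟨c, rfl⟩ := AdicCompletion.mk_surjective _ _ y
  -- The preimage is the limit of the `r n`, obtained by truncating `c n ∈ B ⊆ R̂` modulo `𝔪_R ^ n`.
  choose r hr using fun n => Ideal.Quotient.mk_surjective
    (AdicCompletion.evalₐ (maximalIdeal R) n (intermediateVal B (c n)))
  have hcauchy : ∀ n, r n ≡ r (n + 1) [SMOD (maximalIdeal R ^ n • ⊤ : Submodule R R)] := by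
    intro n
    have hc : c n - c (n + 1) ∈ maximalIdeal B ^ n :=
      Ideal.Quotient.mk_eq_mk_iff_sub_mem _ _ |>.mp
        (AdicCompletion.Ideal.mk_eq_mk _ n.le_succ c).symm
    have h1 := evalₐ_intermediateVal_eq_zero hc
    rw [map_sub, map_sub, sub_eq_zero, ← hr, evalₐ_eq_factorPow n.le_succ, ← hr] at h1
    rw [SModEq.sub_mem, smul_eq_mul, Ideal.mul_top, ← Ideal.Quotient.mk_eq_mk_iff_sub_mem]
    exact h1
  refine ⟨AdicCompletion.mk _ _ (AdicCompletion.AdicCauchySequence.mk _ _ r hcauchy),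
    AdicCompletion.ext_evalₐ fun n => ?_⟩
  rw [evalₐ_formalCompletionMap, AdicCompletion.evalₐ_mk, AdicCompletion.evalₐ_mk]
  have h2 := evalₐ_formalCompletionMap (A := B) n (intermediateVal B (c n))
  rw [formalCompletionMap_intermediateVal, AlgHom.commutes, ← hr] at h2
  exact h2.symm

end PRadicalClosure

theorem theorem3p7 {R : Type*} [CommRing R] [IsLocalRing R] [IsNoetherianRing R]
    [IsDomain (FormalCompletion R)]
    (B : Subalgebra R (pRadicalClosure R)) [IsNoetherianRing B]
    (hB : HasReducedGenericFormalFiber B) :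
    ramificationIndex R B = 1 ∧
    residualDegree R B = 1 ∧
    Module.FaithfullyFlat R B ∧
    Function.Bijective (formalCompletionMap R B) ∧
    (B ≠ ⊥ → ¬ Module.Finite R B) := by
  have : IsDomain B := (intermediateVal_injective B).isDomain (intermediateVal B)
  have := HasReducedGenericFormalFiber.isReduced B hB
  have hs := formalCompletionMap_surjective_of_intermediate B
  have hb : Function.Bijective (formalCompletionMap R B) :=
    ⟨formalCompletionMap_injective_of_intermediate B, hs⟩
  refine ⟨ramificationIndex_eq_one hs, residualDegree_eq_one hs,
    faithfullyFlat_of_formalCompletionMap_bijective hb, hb, fun hne hfin => hne ?_⟩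
  rw [eq_bot_iff]
  intro b hbB
  obtain ⟨r, hr⟩ := algebraMap_surjective_of_finite hs ⟨b, hbB⟩
  exact ⟨r, congrArg Subtype.val hr⟩
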